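/- **Lemma.** Let $L>0$, $M\ge 0$, $\Pi^3=[-L,L]^3\subset\mathbb R^3$, and let $(\varphi_j)_{j\in\mathbb N}$ be a sequence of (real- or complex-valued) functions on $\mathbb R^3$ that are $2L$-periodic in each coordinate and satisfy $\varphi_j\in L^\infty(\Pi^3)$, $\|\varphi_j\|_{L^\infty(\Pi^3)}\le M$ for all $j$. For $0\le s<t\le \frac L2$ and $n\in\mathbb S^2$ define $$L_{n,t-s}[\varphi_j](x)=\int_s^t\varphi_j(x-\lambda n)\,d\lambda ,$$ and let $\fint_{\mathbb S^2}dn$ denote the mean with respect to surface measure on the unit sphere $\mathbb S^2\subset\mathbb R^3$. Then the following hold. 1. For all $j$ and all $0\le s<t\le\frac L2$, the integral $L_{n,t-s}[\varphi_j](x)$ exists for almost every $(x,n)\in\mathbb R^3\times\mathbb S^2$, and $(x,n)\mapsto L_{n,t-s}[\varphi_j](x)$ belongs to $L^\infty(\mathbb R^3\times\mathbb S^2)$. 2. For every $\varepsilon>0$ there exists $h_0>0$ such that $$\int_{\Pi^3}\Big|\fint_{\mathbb S^2}\big(L_{n,t-s}[\varphi_j](x)-L_{n,t-s}[\varphi_j](x+h)\big)\,dn\Big|^2dx\;\le\;\int_{\Pi^3}\fint_{\mathbb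 S^2}\big|L_{n,t-s}[\varphi_j](x)-L_{n,t-s}[\varphi_j](x+h)\big|^2\,dn\,dx\;<\;\varepsilon$$ for all $h\in\mathbb R^3$ with $|h|<h_0$, all $j\in\mathbb N$ and all $s,t$ with $0\le s<t\le\frac L2$. 3. For every $m\in\mathbb N$ the functions $x\mapsto\fint_{\mathbb S^2}\big(L_{n,t-s}[\varphi_j](x)\big)^m\,dn$ with $j\in\mathbb N$ and $0\le s<t\le\frac L2$ belong to $L^2(\Pi^3)$ and form a relatively compact subset of $L^2(\Pi^3)$. In particular, for fixed $s,t$ the sequence indexed by $j$ is relatively compact in $L^2(\Pi^3)$. -/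

import Mathlib

open MeasureTheory
open scoped ENNReal

noncomputable section

namespace LineAvg

/-- Euclidean space `ℝ³`. -/
abbrev R3 : Type := EuclideanSpace ℝ (Fin 3)

/-- The unit sphere `S²` of `ℝ³`. -/
abbrev S2 : Type := Metric.sphere (0 : R3) 1

/-- The surface measure `dn` on `S²` (of total mass `4π`). -/
def sphereMeasure : Measure S2 := (volume : Measure R3).toSphere

/-- The closed cube `[-L, L]³`. -/
def cube (L : ℝ) : Set R3 := {x | ∀ i, x i ∈ Set.Icc (-L) L}

/-- `f` is `2L`-periodic in each of the three coordinate directions. -/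
def CubePeriodic {α : Type*} (L : ℝ) (f : R3 → α) : Prop :=
  ∀ (i : Fin 3) (x : R3), f (x + EuclideanSpace.single i (2 * L)) = f x

/-- The partial line integral `L_{n,t-s}[f](x) = ∫_s^t f(x - r n) dr`. -/
def lineInt {𝕜 : Type*} [RCLike 𝕜] (f : R3 → 𝕜) (s t : ℝ) (n : S2) (x : R3) : 𝕜 :=
  ∫ r in s..t, f (x - r • (n : R3))

/-- The mean over the sphere of the `m`-th power of the line integral,
`x ↦ ⨍_{S²} (L_{n,t-s}[f](x))^m dn`. -/
def powerAvg {𝕜 : Type*} [RCLike 𝕜] (f : R3 → 𝕜) (m : ℕ) (s t : ℝ) (x : R3) : 𝕜 :=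
  ⨍ n, (lineInt f s t n x) ^ m ∂sphereMeasure

end LineAvg

end

/-! Integrating along a ray and then over the sphere is a volume integral: in polar coordinates `dr
dn = |y|⁻² dy`, and `|y|⁻²` is locally integrable on `ℝ³`. This is where the regularity comes from;
a single line integral does not smooth across its direction.

Let `g = f - f(· + h)` with `|f| ≤ C`. In the squared `L²` norm of the line integral of `g` over
`(x, n)`, write one factor as an integral over `a ∈ [s, t]` and translate `x` by `a n`, which
periodicity permits. The result (`energy_eq`) pairs `g(x)` with the sphere and line integral of `g(x
+ (a - r) n)`. The latter is an integral of `g` against the kernels `1_{|y| < b} |y|⁻²` with `b = a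
- s` and `b = t - a`. There the shift `h` can be moved from `f` to the kernel, at the cost of `C`
times an `L¹` modulus of continuity (`norm_integral_sphere_sub_le`); the other factor is only
bounded by `2C`. Thus nothing about `f` enters but `C`, which gives uniformity in `j`. Integrating
over the radius `b` gives uniformity in `s, t`, and continuity of translations in `L¹` gives
convergence to `0` (`tendsto_integral_polarModulus`).

Powers are Lipschitz on bounded sets, so the power averages also have uniformly small translates,
and the Kolmogorov–Riesz criterion `isCompact_closure_L2_of_translates` applies. All this is done
for everywhere bounded measurable periodic representatives. A null set of `ℝ³` meets almost every
line in a null set, so the conclusions carry over to the given functions. -/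

open scoped Pointwise

noncomputable section

namespace LineAvg

/-! ### Periodicity, the lattice `2L ℤ³` and its fundamental cube -/

/-- The basis `2L e₁, 2L e₂, 2L e₃` of `ℝ³`. -/
def cubeBasis {L : ℝ} (hL : 0 < L) : Module.Basis (Fin 3) ℝ R3 :=
  (EuclideanSpace.basisFun (Fin 3) ℝ).toBasis.isUnitSMul
    (w := fun _ => 2 * L) (fun _ => (by positivity : (2 * L) ≠ 0).isUnit)

theorem cubeBasis_apply {L : ℝ} (hL : 0 < L) (i : Fin 3) :
    cubeBasis hL i = EuclideanSpace.single i (2 * L) := by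
  ext j
  simp [cubeBasis, Module.Basis.isUnitSMul_apply]

theorem cubeBasis_repr {L : ℝ} (hL : 0 < L) (x : R3) (i : Fin 3) :
    (cubeBasis hL).repr x i = x i / (2 * L) := by
  have h : x = ∑ j, (x j / (2 * L)) • cubeBasis hL j := by
    ext k
    have : L ≠ 0 := hL.ne'
    simp [cubeBasis_apply, Pi.single_apply]
    field_simp
  conv_lhs => rw [h]
  rw [(cubeBasis hL).repr_sum_self]

/-- The lattice `2L ℤ³`. -/
abbrev cubeLattice {L : ℝ} (hL : 0 < L) : AddSubgroup R3 :=
  (Submodule.span ℤ (Set.range (cubeBasis hL))).toAddSubgroup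

instance {L : ℝ} (hL : 0 < L) : Countable (cubeLattice hL) :=
  inferInstanceAs (Countable (Submodule.span ℤ (Set.range (cubeBasis hL))))

theorem CubePeriodic.add_mem {α : Type*} {L : ℝ} {f : R3 → α} (hL : 0 < L)
    (hf : CubePeriodic L f) {v : R3} (hv : v ∈ cubeLattice hL) (x : R3) : f (x + v) = f x := by
  induction hv using Submodule.span_induction generalizing x with
  | mem v hv =>
    obtain ⟨i, rfl⟩ := hv
    rw [cubeBasis_apply, hf]
  | zero => simp
  | add u v _ _ hu hv => rw [← add_assoc, hv, hu]
  | smul a v _ hv =>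
    induction a using Int.induction_on generalizing x with
    | zero => simp
    | succ n ih => rw [add_smul, one_smul, ← add_assoc, hv, ih]
    | pred n ih =>
      rw [← ih x, ← hv (x + (-(n : ℤ) - 1) • v)]
      congr 1
      module

theorem CubePeriodic.comp_add {α : Type*} {L : ℝ} {f : R3 → α}
    (hf : CubePeriodic L f) (v : R3) : CubePeriodic L (fun x => f (x + v)) := by
  intro i x
  dsimp only
  rw [add_right_comm, hf]

/-- The half-open cube `[-L, L)³`. -/
def boxIco (L : ℝ) : Set R3 := {x | ∀ i, x i ∈ Set.Ico (-L) L}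

/-- The box is the standard fundamental domain `[0, 2L)³` translated by `(-L, -L, -L)`. -/
theorem isAddFundamentalDomain_boxIco {L : ℝ} (hL : 0 < L) :
    IsAddFundamentalDomain (cubeLattice hL) (boxIco L) (volume : Measure R3) := by
  have h := (ZSpan.isAddFundamentalDomain' (cubeBasis hL) (volume : Measure R3)).vadd_of_comm
    (WithLp.toLp 2 (fun _ => -L) : R3)
  suffices hs : boxIco L =
      (WithLp.toLp 2 (fun _ => -L) : R3) +ᵥ ZSpan.fundamentalDomain (cubeBasis hL) by
    rw [hs]; exact h
  ext x
  rw [Set.mem_vadd_set_iff_neg_vadd_mem, ZSpan.mem_fundamentalDomain]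
  refine forall_congr' fun i => ?_
  rw [cubeBasis_repr]
  have h2 : 0 < 2 * L := by positivity
  simp only [Set.mem_Ico, vadd_eq_add, PiLp.add_apply, PiLp.neg_apply, neg_neg]
  rw [le_div_iff₀ h2, div_lt_one h2, zero_mul]
  constructor <;> rintro ⟨h1, h2⟩ <;> constructor <;> linarith

theorem isCompact_cube (L : ℝ) : IsCompact (cube L) := by
  have : cube L = WithLp.ofLp ⁻¹' Set.pi Set.univ (fun _ : Fin 3 => Set.Icc (-L) L) := by
    ext; simp [cube, -Set.pi_univ_Icc]
  rw [this]
  exact (PiLp.homeomorph 2 (fun _ : Fin 3 => ℝ)).isCompact_preimage.2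
    (isCompact_univ_pi fun _ => isCompact_Icc)

theorem volume_cube_lt_top (L : ℝ) : volume (cube L) < ∞ := (isCompact_cube L).measure_lt_top

instance (L : ℝ) : IsFiniteMeasure (volume.restrict (cube L)) :=
  ⟨by simpa using volume_cube_lt_top L⟩

theorem boxIco_ae_eq_cube (L : ℝ) : boxIco L =ᵐ[volume] cube L := by
  have h := Measure.univ_pi_Ico_ae_eq_Icc (μ := fun _ : Fin 3 => (volume : Measure ℝ))
    (f := fun _ => -L) (g := fun _ => L)
  have h' := (PiLp.volume_preserving_ofLp (Fin 3)).quasiMeasurePreserving.preimage_ae_eq h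
  have e1 : boxIco L = WithLp.ofLp ⁻¹' Set.univ.pi fun _ : Fin 3 => Set.Ico (-L) L := by
    ext; simp [boxIco]
  have e2 : cube L = WithLp.ofLp ⁻¹' Set.Icc (fun _ : Fin 3 => -L) fun _ => L := by
    ext; simp [cube, Pi.le_def, forall_and]
  rwa [e1, e2]

/-- The translated box is again a fundamental domain, and an invariant function has the same
integral over any two of them. -/
theorem CubePeriodic.setIntegral_add {E : Type*} [NormedAddCommGroup E] [NormedSpace ℝ E]
    {L : ℝ} {f : R3 → E} (hL : 0 < L) (hf : CubePeriodic L f) (v : R3) :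
    ∫ x in cube L, f (x + v) = ∫ x in cube L, f x := by
  rw [← setIntegral_congr_set (boxIco_ae_eq_cube L), ← setIntegral_congr_set (boxIco_ae_eq_cube L)]
  have hF := isAddFundamentalDomain_boxIco hL
  have h1 := hF.setIntegral_eq (hF.vadd_of_comm v) (f := f)
    (fun g x => by
      rw [AddSubgroup.vadd_def, vadd_eq_add, add_comm, hf.add_mem hL g.2])
  rw [h1]
  have h2 := (measurePreserving_add_right volume v).setIntegral_preimage_emb
    (measurableEmbedding_addRight v) f (v +ᵥ boxIco L)
  rw [← h2]
  congr 2
  ext x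
  simp [Set.mem_vadd_set_iff_neg_vadd_mem]

/-! ### Bounded measurable periodic representatives -/

/-- The representative in `[-L, L)³` of a point modulo `2L ℤ³`. -/
def foldCube (L : ℝ) (x : R3) : R3 :=
  WithLp.toLp 2 fun i => -L + Int.fract ((x i + L) / (2 * L)) * (2 * L)

theorem measurable_foldCube (L : ℝ) : Measurable (foldCube L) := by
  refine (WithLp.measurable_toLp 2 (Fin 3 → ℝ)).comp (measurable_pi_lambda _ fun i => ?_)
  have : Measurable fun x : R3 => Int.fract ((x i + L) / (2 * L)) :=
    Measurable.fract (by fun_prop)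
  fun_prop

theorem cubePeriodic_foldCube {L : ℝ} (hL : 0 < L) : CubePeriodic L (foldCube L) := by
  intro i x
  ext j
  have : (2 * L) ≠ 0 := by positivity
  by_cases hij : j = i
  · subst hij
    have e : (x j + 2 * L + L) / (2 * L) = (x j + L) / (2 * L) + 1 := by field_simp; ring
    simp [foldCube, e]
  · simp [foldCube, hij]

theorem foldCube_of_mem {L : ℝ} (hL : 0 < L) {x : R3} (hx : x ∈ boxIco L) : foldCube L x = x := by
  ext i
  have h2 : 0 < 2 * L := by positivity
  have h : Int.fract ((x i + L) / (2 * L)) = (x i + L) / (2 * L) := by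
    rw [Int.fract_eq_self]
    have := hx i
    exact ⟨div_nonneg (by linarith [this.1]) h2.le, (div_lt_one h2).2 (by linarith [this.2])⟩
  simp only [foldCube, h]
  field_simp
  ring

variable {𝕜 : Type*} [RCLike 𝕜]

/-- An essentially bounded periodic function agrees almost everywhere with a bounded measurable
periodic function. -/
theorem CubePeriodic.exists_bounded_representative {L C : ℝ} (hL : 0 < L) (hC : 0 ≤ C)
    {f : R3 → 𝕜} (hf : CubePeriodic L f)
    (hm : AEStronglyMeasurable f (volume.restrict (cube L)))
    (hb : eLpNorm f ∞ (volume.restrict (cube L)) ≤ ENNReal.ofReal C) :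
    ∃ g : R3 → 𝕜, StronglyMeasurable g ∧ CubePeriodic L g ∧ (∀ x, ‖g x‖ ≤ C) ∧
      f =ᵐ[volume] g := by
  classical
  set u := hm.mk f with hu
  have hum : StronglyMeasurable u := hm.stronglyMeasurable_mk
  -- Truncation makes the bound hold everywhere; composing with `foldCube` then makes the function
  -- periodic.
  set v : R3 → 𝕜 := {x | ‖u x‖ ≤ C}.indicator u with hv
  have hvm : StronglyMeasurable v :=
    hum.indicator (measurableSet_le hum.norm.measurable measurable_const)
  refine ⟨fun x => v (foldCube L x), hvm.comp_measurable (measurable_foldCube L), ?_, ?_, ?_⟩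
  · intro i x
    dsimp only
    rw [cubePeriodic_foldCube hL]
  · intro x
    by_cases hx : ‖u (foldCube L x)‖ ≤ C <;> simp [hv, hx, hC]
  · have hbd : ∀ᵐ x ∂volume.restrict (cube L), ‖f x‖ ≤ C := by
      have := ae_le_eLpNormEssSup (f := f) (μ := volume.restrict (cube L))
      rw [← eLpNorm_exponent_top] at this
      filter_upwards [this] with x hx
      have h3 := hx.trans hb
      rwa [← ofReal_norm, ENNReal.ofReal_le_ofReal_iff hC] at h3
    have hae : ∀ᵐ x ∂volume.restrict (boxIco L), f x = v (foldCube L x) := by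
      rw [Measure.restrict_congr_set (boxIco_ae_eq_cube L)]
      have hmem : ∀ᵐ x ∂volume.restrict (cube L), x ∈ boxIco L := by
        rw [← Measure.restrict_congr_set (boxIco_ae_eq_cube L)]
        refine ae_restrict_mem₀ (isAddFundamentalDomain_boxIco hL).nullMeasurableSet
      filter_upwards [hbd, hm.ae_eq_mk, hmem] with x h1 h2 h3
      rw [foldCube_of_mem hL h3]
      rw [h2] at h1
      simp [hv, hu, h1, h2]
    have hF := isAddFundamentalDomain_boxIco hL
    -- The exceptional set is lattice invariant and null in a fundamental domain, hence null in
    -- `ℝ³`.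
    have := hF.measure_zero_of_invariant {x | f x ≠ v (foldCube L x)} ?_ ?_
    · exact this
    · rintro g
      refine Set.ext fun x => ?_
      rw [Set.mem_vadd_set_iff_neg_vadd_mem, AddSubgroup.vadd_def, vadd_eq_add, add_comm]
      simp only [Set.mem_ofPred_eq]
      rw [hf.add_mem hL (-g).2, (cubePeriodic_foldCube hL).add_mem hL (-g).2]
    · have h := hae
      rw [ae_iff, Measure.restrict_apply₀' hF.nullMeasurableSet] at h
      exact h

/-! ### Line integrals: independence of the representative, measurability, bounds -/

open Filter Topology

instance : IsFiniteMeasure sphereMeasure := by unfold sphereMeasure; infer_instance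

instance : NeZero sphereMeasure := ⟨by unfold sphereMeasure; simp⟩

/-- For fixed direction and parameter the map is a translation of `ℝ³`, so by Fubini preimages of
null sets are null. Hence changing `f` on a null set does not affect almost every line integral. -/
theorem quasiMeasurePreserving_sub_smul :
    Measure.QuasiMeasurePreserving (fun p : (R3 × S2) × ℝ => p.1.1 - p.2 • (p.1.2 : R3))
      ((volume.prod sphereMeasure).prod volume) volume := by
  have h : Measure.QuasiMeasurePreserving (fun p : R3 × (S2 × ℝ) => p.1 - p.2.2 • (p.2.1 : R3))
      (volume.prod (sphereMeasure.prod volume)) volume := by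
    refine QuasiMeasurePreserving.prod_of_left (by fun_prop) (Eventually.of_forall ?_)
    intro y
    exact (measurePreserving_sub_right (volume : Measure R3) (y.2 • (y.1 : R3))).quasiMeasurePreserving
  exact h.comp (measurePreserving_prodAssoc _ _ _).quasiMeasurePreserving

theorem ae_ae_eq_sub_smul {α : Type*} {f g : R3 → α} (h : f =ᵐ[volume] g) :
    ∀ᵐ p : R3 × S2 ∂(volume.prod sphereMeasure), ∀ᵐ r : ℝ,
      f (p.1 - r • (p.2 : R3)) = g (p.1 - r • (p.2 : R3)) :=
  Measure.ae_ae_of_ae_prod (quasiMeasurePreserving_sub_smul.ae h)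

theorem lineInt_ae_eq {f g : R3 → 𝕜} (h : f =ᵐ[volume] g) (s t : ℝ) :
    ∀ᵐ p : R3 × S2 ∂(volume.prod sphereMeasure), lineInt f s t p.2 p.1 = lineInt g s t p.2 p.1 := by
  filter_upwards [ae_ae_eq_sub_smul h] with p hp
  exact intervalIntegral.integral_congr_ae (hp.mono fun r hr _ => hr)

theorem stronglyMeasurable_intervalIntegral {α : Type*} [MeasurableSpace α] {F : α → ℝ → 𝕜}
    (hF : StronglyMeasurable (Function.uncurry F)) (s t : ℝ) :
    StronglyMeasurable fun a => ∫ r in s..t, F a r := by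
  unfold intervalIntegral
  exact hF.integral_prod_right.sub hF.integral_prod_right

theorem stronglyMeasurable_lineInt {f : R3 → 𝕜} (hf : StronglyMeasurable f) (s t : ℝ) :
    StronglyMeasurable fun p : R3 × S2 => lineInt f s t p.2 p.1 := by
  refine stronglyMeasurable_intervalIntegral (F := fun (p : R3 × S2) r => f (p.1 - r • (p.2 : R3)))
    ?_ s t
  exact hf.comp_measurable (by fun_prop)

theorem norm_lineInt_le {f : R3 → 𝕜} {C : ℝ} (hf : ∀ x, ‖f x‖ ≤ C) (s t : ℝ) (n : S2) (x : R3) :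
    ‖lineInt f s t n x‖ ≤ C * |t - s| :=
  intervalIntegral.norm_integral_le_of_norm_le_const fun _ _ => hf _

theorem intervalIntegrable_of_bounded {f : ℝ → 𝕜} {C : ℝ} (hf : StronglyMeasurable f)
    (hb : ∀ x, ‖f x‖ ≤ C) (s t : ℝ) : IntervalIntegrable f volume s t :=
  (intervalIntegrable_const (c := C)).mono_fun' hf.aestronglyMeasurable
    (Eventually.of_forall fun x => hb x)

theorem integrable_of_bounded {α : Type*} [MeasurableSpace α] {μ : Measure α} [IsFiniteMeasure μ]
    {E : Type*} [NormedAddCommGroup E] {f : α → E} {C : ℝ} (hf : StronglyMeasurable f)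
    (hb : ∀ x, ‖f x‖ ≤ C) : Integrable f μ :=
  (integrable_const C).mono' hf.aestronglyMeasurable (Eventually.of_forall hb)

/-! ### Translations in `L¹` and the polar kernel -/

/-- Continuity of translations in `L¹`. -/
theorem tendsto_integral_norm_translate_sub {G : Type*} [NormedAddCommGroup G] [MeasurableSpace G]
    [BorelSpace G] [SecondCountableTopology G] [LocallyCompactSpace G] (μ : Measure G)
    [μ.IsAddHaarMeasure]
    {k : G → ℝ} (hk : Integrable k μ) :
    Tendsto (fun v : G => ∫ x, ‖k (v + x) - k x‖ ∂μ) (𝓝 0) (𝓝 0) := by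
  have hm : MemLp k 1 μ := memLp_one_iff_integrable.2 hk
  have : Fact ((1 : ℝ≥0∞) ≠ ∞) := ⟨ENNReal.one_ne_top⟩
  have hc : Continuous fun v : G => dist (DomAddAct.mk v +ᵥ hm.toLp k) (hm.toLp k) := by
    have : Continuous (DomAddAct.mk : G → Gᵈᵃᵃ) := DomAddAct.continuous_mk
    fun_prop
  have h0 := hc.tendsto 0
  have hz : dist (DomAddAct.mk (0 : G) +ᵥ hm.toLp k) (hm.toLp k) = 0 := by simp
  rw [hz] at h0
  refine h0.congr fun v => ?_
  rw [dist_eq_norm, L1.norm_eq_integral_norm]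
  refine integral_congr_ae ?_
  filter_upwards [Lp.coeFn_sub (DomAddAct.mk v +ᵥ hm.toLp k) (hm.toLp k), hm.coeFn_toLp,
    DomAddAct.vadd_Lp_ae_eq (DomAddAct.mk v) (hm.toLp k),
    (measurePreserving_add_left μ v).quasiMeasurePreserving.ae hm.coeFn_toLp] with x h1 h2 h3 h4
  rw [h1, Pi.sub_apply, h2, h3]
  simp only [Equiv.symm_apply_apply, vadd_eq_add, h4]

/-- The kernel `1_{‖y‖ < b} ‖y‖⁻²`. -/
def polarKernel (b : ℝ) (y : R3) : ℝ := (Metric.ball (0 : R3) b).indicator (fun y => (‖y‖ ^ 2)⁻¹) y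

/-- The radial Jacobian `r²` in dimension three cancels the singularity `r⁻²`. -/
theorem integrable_polarKernel (b : ℝ) : Integrable (polarKernel b) volume := by
  unfold polarKernel
  rw [integrable_indicator_iff Metric.isOpen_ball.measurableSet]
  rw [integrableOn_fun_norm_addHaar volume (f := fun r : ℝ => (r ^ 2)⁻¹)]
  have : IntegrableOn (fun _ : ℝ => (1 : ℝ)) (Set.Ioo 0 b) := by simp
  refine this.congr_fun (fun r hr => ?_) measurableSet_Ioo
  have : r ≠ 0 := hr.1.ne'
  simp [this]

theorem measurable_uncurry_polarKernel : Measurable fun p : ℝ × R3 => polarKernel p.1 p.2 := by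
  have : (fun p : ℝ × R3 => polarKernel p.1 p.2) =
      {p : ℝ × R3 | ‖p.2‖ < p.1}.indicator (fun p => (‖p.2‖ ^ 2)⁻¹) := by
    ext p
    simp [polarKernel, Set.indicator]
  rw [this]
  exact Measurable.indicator (by fun_prop) (measurableSet_lt (by fun_prop) (by fun_prop))

theorem polarKernel_nonneg (b : ℝ) (y : R3) : 0 ≤ polarKernel b y :=
  Set.indicator_nonneg (fun _ _ => by positivity) _

theorem polarKernel_neg (b : ℝ) (y : R3) : polarKernel b (-y) = polarKernel b y := by
  simp [polarKernel, Set.indicator]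

/-- Polar coordinates off the origin: volume becomes the product of `sphereMeasure` and `r² dr`, and
the kernel removes the weight `r²`. -/
theorem integral_sphere_intervalIntegral_eq {F : R3 → 𝕜} {C : ℝ} (hF : StronglyMeasurable F)
    (hb : ∀ x, ‖F x‖ ≤ C) {b : ℝ} (hb0 : 0 ≤ b) :
    ∫ n : S2, (∫ r in (0 : ℝ)..b, F (r • (n : R3))) ∂sphereMeasure =
      ∫ y, polarKernel b y • F y := by
  set G : R3 → 𝕜 := fun y => polarKernel b y • F y with hG
  have hGi : Integrable G volume :=
    (integrable_polarKernel b).smul_bdd C hF.aestronglyMeasurable (Eventually.of_forall hb)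
  have hmp := (volume : Measure R3).measurePreserving_homeomorphUnitSphereProd
  have hemb := (homeomorphUnitSphereProd R3).measurableEmbedding
  have e0 : ∀ x : ({0}ᶜ : Set R3), G x = (fun p : S2 × Set.Ioi (0 : ℝ) => G ((p.2 : ℝ) • (p.1 : R3)))
      (homeomorphUnitSphereProd R3 x) := by
    intro x
    have : ‖(x : R3)‖ ≠ 0 := norm_ne_zero_iff.2 x.2
    simp [smul_smul, this]
  have e1 : ∫ y, G y = ∫ p : S2 × Set.Ioi (0 : ℝ), G ((p.2 : ℝ) • (p.1 : R3))
      ∂((volume : Measure R3).toSphere.prod (Measure.volumeIoiPow (Module.finrank ℝ R3 - 1))) := by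
    rw [← hmp.integral_comp hemb]
    conv_lhs => rw [← restrict_compl_singleton (μ := (volume : Measure R3)) 0,
      ← integral_subtype_comap (measurableSet_singleton _).compl]
    exact integral_congr_ae (Eventually.of_forall e0)
  have hi : Integrable (fun p : S2 × Set.Ioi (0 : ℝ) => G ((p.2 : ℝ) • (p.1 : R3)))
      ((volume : Measure R3).toSphere.prod (Measure.volumeIoiPow (Module.finrank ℝ R3 - 1))) := by
    rw [← hmp.integrable_comp_emb hemb]
    rw [← restrict_compl_singleton (μ := (volume : Measure R3)) 0, ← IntegrableOn,
      integrableOn_iff_comap_subtypeVal (measurableSet_singleton _).compl] at hGi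
    exact hGi.congr (Eventually.of_forall e0)
  rw [e1, integral_prod _ hi]
  refine integral_congr_ae (Eventually.of_forall fun n => ?_)
  dsimp only
  have hd : Module.finrank ℝ R3 - 1 = 2 := by simp
  rw [hd, Measure.volumeIoiPow]
  simp only [ENNReal.ofReal]
  rw [integral_withDensity_eq_integral_smul (by fun_prop),
    integral_subtype_comap measurableSet_Ioi
      (fun r : ℝ => Real.toNNReal (r ^ 2) • G (r • (n : R3))),
    intervalIntegral.integral_of_le hb0, integral_Ioc_eq_integral_Ioo]
  rw [← integral_indicator measurableSet_Ioi, ← integral_indicator measurableSet_Ioo]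
  refine integral_congr_ae (Eventually.of_forall fun r => ?_)
  have hn : ‖(n : R3)‖ = 1 := by simp
  by_cases h0 : 0 < r
  · have hr : ‖r • (n : R3)‖ = r := by rw [norm_smul, hn, mul_one, Real.norm_of_nonneg h0.le]
    by_cases h1 : r < b
    · have : r ≠ 0 := h0.ne'
      simp [Set.indicator, h0, h1, hG, polarKernel, hr, NNReal.smul_def, smul_smul, this,
        Real.coe_toNNReal _ (sq_nonneg r)]
    · simp [Set.indicator, h1, hG, polarKernel, hr]
  · simp [Set.indicator, h0]

/-! ### The energy identity and the translation estimate -/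

open scoped ComplexConjugate

/-- A change of variables moves the shift from `f`, which is merely bounded, to the integrable
kernel. -/
theorem norm_integral_kernel_smul_sub_le {f : R3 → 𝕜} {C : ℝ} (hf : StronglyMeasurable f)
    (hb : ∀ x, ‖f x‖ ≤ C) {κ : R3 → ℝ} (hκ : Integrable κ volume) (x h : R3) :
    ‖∫ y, κ y • (f (x + y) - f (x + y + h))‖ ≤ C * ∫ y, ‖κ (-h + y) - κ y‖ := by
  have hm : ∀ z : R3, AEStronglyMeasurable (fun y => f (x + y + z)) volume := fun z =>
    (hf.comp_measurable (by fun_prop)).aestronglyMeasurable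
  have hi : ∀ (z : R3) {κ' : R3 → ℝ}, Integrable κ' volume →
      Integrable (fun y => κ' y • f (x + y + z)) volume := fun z κ' hκ' =>
    hκ'.smul_bdd C (hm z) (Eventually.of_forall fun y => hb _)
  have hκh : Integrable (fun y => κ (-h + y)) volume := hκ.comp_add_left (-h)
  have e : ∫ y, κ y • (f (x + y) - f (x + y + h)) = ∫ y, (κ y - κ (-h + y)) • f (x + y + 0) := by
    have h1 : ∫ y, κ y • f (x + y + h) = ∫ y, κ (-h + y) • f (x + y + 0) := by
      rw [← integral_add_left_eq_self (fun y => κ (-h + y) • f (x + y + 0)) h]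
      refine integral_congr_ae (Eventually.of_forall fun y => ?_)
      simp only [neg_add_cancel_left, add_zero]
      congr 2
      abel
    simp only [smul_sub, sub_smul]
    rw [integral_sub (by simpa using hi 0 hκ) (hi h hκ), integral_sub (hi 0 hκ) (hi 0 hκh), h1]
    simp
  rw [e]
  refine (norm_integral_le_integral_norm _).trans ?_
  rw [← integral_const_mul]
  refine integral_mono ((hκ.sub hκh).smul_bdd C (hm 0)
    (Eventually.of_forall fun y => hb _)).norm ((hκh.sub hκ).norm.const_mul C) fun y => ?_
  dsimp only
  rw [norm_smul, mul_comm, norm_sub_rev]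
  exact mul_le_mul_of_nonneg_right (hb _) (norm_nonneg _)

theorem integral_integral_swap_of_bounded {α β : Type*} [MeasurableSpace α] [MeasurableSpace β]
    {μ : Measure α} {ν : Measure β} [IsFiniteMeasure μ] [IsFiniteMeasure ν]
    {Φ : α → β → 𝕜} {C : ℝ} (hΦ : StronglyMeasurable fun p : α × β => Φ p.1 p.2)
    (hb : ∀ a b, ‖Φ a b‖ ≤ C) :
    ∫ a, ∫ b, Φ a b ∂ν ∂μ = ∫ b, ∫ a, Φ a b ∂μ ∂ν :=
  integral_integral_swap (integrable_of_bounded hΦ fun p => hb p.1 p.2)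

theorem integral_integral_integral_rotate {α β γ : Type*} [MeasurableSpace α] [MeasurableSpace β]
    [MeasurableSpace γ] {μ : Measure α} {ν : Measure β} {τ : Measure γ} [IsFiniteMeasure μ]
    [IsFiniteMeasure ν] [IsFiniteMeasure τ] {Φ : α → β → γ → 𝕜} {C : ℝ}
    (hΦ : StronglyMeasurable fun p : α × β × γ => Φ p.1 p.2.1 p.2.2)
    (hb : ∀ a b c, ‖Φ a b c‖ ≤ C) :
    ∫ a, ∫ b, ∫ c, Φ a b c ∂τ ∂ν ∂μ = ∫ c, ∫ b, ∫ a, Φ a b c ∂μ ∂ν ∂τ := by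
  have h1 : ∀ a, ∫ b, ∫ c, Φ a b c ∂τ ∂ν = ∫ c, ∫ b, Φ a b c ∂ν ∂τ := fun a =>
    integral_integral_swap_of_bounded (hΦ.comp_measurable (by fun_prop : Measurable
      fun p : β × γ => (a, p.1, p.2))) (hb a)
  have h2 : ∀ c, ∫ a, ∫ b, Φ a b c ∂ν ∂μ = ∫ b, ∫ a, Φ a b c ∂μ ∂ν := fun c =>
    integral_integral_swap_of_bounded (hΦ.comp_measurable (by fun_prop : Measurable
      fun p : α × β => (p.1, p.2, c))) (fun a b => hb a b c)
  simp_rw [h1, ← h2]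
  refine integral_integral_swap_of_bounded (C := C * ν.real Set.univ)
    (Φ := fun a c => ∫ b, Φ a b c ∂ν) ?_ fun a c => ?_
  · exact StronglyMeasurable.integral_prod_right (f := fun (p : α × γ) b => Φ p.1 b p.2)
      (hΦ.comp_measurable (by fun_prop : Measurable fun q : (α × γ) × β => (q.1.1, q.2, q.1.2)))
  · exact norm_integral_le_of_norm_le_const (Eventually.of_forall fun b => hb a b c)

/-- Only one factor of the square is expanded as an integral over `a`. Once the `x`-integral is
innermost, translating by `a n` frees `g x` from `n`, so the sphere integral falls on the other
factor alone. -/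
theorem energy_eq {L B : ℝ} (hL : 0 < L) {g : R3 → 𝕜} (hg : StronglyMeasurable g)
    (hper : CubePeriodic L g) (hb : ∀ x, ‖g x‖ ≤ B) {s t : ℝ} (hst : s ≤ t) :
    ((∫ x in cube L, ∫ n, ‖lineInt g s t n x‖ ^ 2 ∂sphereMeasure : ℝ) : 𝕜) =
      ∫ a in s..t, ∫ x in cube L,
        g x * conj (∫ n : S2, (∫ r in s..t, g (x + (a - r) • (n : R3))) ∂sphereMeasure) := by
  have hB : 0 ≤ B := (norm_nonneg _).trans (hb 0)
  have hlm := stronglyMeasurable_lineInt hg s t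
  have hlb := norm_lineInt_le hb s t
  have e1 : ((∫ x in cube L, ∫ n, ‖lineInt g s t n x‖ ^ 2 ∂sphereMeasure : ℝ) : 𝕜) =
      ∫ x in cube L, ∫ n : S2, (∫ a in Set.Ioc s t,
        g (x - a • (n : R3)) * conj (lineInt g s t n x)) ∂sphereMeasure := by
    rw [← integral_ofReal]
    refine integral_congr_ae (Eventually.of_forall fun x => ?_)
    dsimp only
    rw [← integral_ofReal]
    refine integral_congr_ae (Eventually.of_forall fun n => ?_)
    dsimp only
    rw [integral_mul_const, ← intervalIntegral.integral_of_le hst]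
    change _ = lineInt g s t n x * _
    rw [RCLike.mul_conj]
    push_cast
    rfl
  rw [e1, integral_integral_integral_rotate (C := B * (B * |t - s|)),
    intervalIntegral.integral_of_le hst]
  · refine integral_congr_ae (Eventually.of_forall fun a => ?_)
    dsimp only
    have e2 : ∀ n : S2, ∫ x in cube L, g (x - a • (n : R3)) * conj (lineInt g s t n x) =
        ∫ x in cube L, g x * conj (∫ r in s..t, g (x + (a - r) • (n : R3))) := by
      intro n
      have hp : CubePeriodic L fun x => g (x - a • (n : R3)) * conj (lineInt g s t n x) := by
        intro i x
        have : ∀ v : R3, g (x + EuclideanSpace.single i (2 * L) - v) = g (x - v) := fun v => by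
          rw [add_sub_right_comm, hper]
        simp only [lineInt, this]
      -- The integrand is periodic in `x`, so the shift does not change its integral over the cube.
      rw [← hp.setIntegral_add hL (a • (n : R3))]
      refine integral_congr_ae (Eventually.of_forall fun x => ?_)
      simp only [lineInt, add_sub_cancel_right, sub_smul, add_sub_assoc]
    simp_rw [e2]
    have hgm : StronglyMeasurable fun p : S2 × R3 =>
        ∫ r in s..t, g (p.2 + (a - r) • (p.1 : R3)) :=
      stronglyMeasurable_intervalIntegral
        (F := fun (p : S2 × R3) r => g (p.2 + (a - r) • (p.1 : R3)))
        (hg.comp_measurable (by fun_prop)) s t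
    rw [integral_integral_swap_of_bounded (C := B * (B * |t - s|))]
    · refine integral_congr_ae (Eventually.of_forall fun x => ?_)
      dsimp only
      rw [integral_const_mul, integral_conj]
    · exact (hg.comp_measurable measurable_snd).mul
        (RCLike.continuous_conj.comp_stronglyMeasurable hgm)
    · intro n x
      rw [norm_mul, RCLike.norm_conj]
      exact mul_le_mul (hb _) (intervalIntegral.norm_integral_le_of_norm_le_const fun _ _ => hb _)
        (norm_nonneg _) hB
  · refine StronglyMeasurable.mul (hg.comp_measurable (by fun_prop)) ?_
    exact RCLike.continuous_conj.comp_stronglyMeasurable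
      (hlm.comp_measurable (by fun_prop : Measurable fun p : R3 × S2 × ℝ => (p.1, p.2.1)))
  · intro x n a
    rw [norm_mul, RCLike.norm_conj]
    exact mul_le_mul (hb _) (hlb _ _) (norm_nonneg _) hB

/-- The `L¹` distance of the polar kernel `1_{‖y‖ < b} ‖y‖⁻²` to its translate by `h`. -/
def polarModulus (h : R3) (b : ℝ) : ℝ := ∫ y, ‖polarKernel b (-h + y) - polarKernel b y‖

theorem polarModulus_nonneg (h : R3) (b : ℝ) : 0 ≤ polarModulus h b :=
  integral_nonneg fun _ => norm_nonneg _

/-- Splitting at `r = a` gives forward rays of length `a - s` and backward rays of length `t - a`;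
over all `n` each family fills a ball, and the kernel estimate applies to each. -/
theorem norm_integral_sphere_sub_le {f : R3 → 𝕜} {C : ℝ} (hf : StronglyMeasurable f)
    (hb : ∀ x, ‖f x‖ ≤ C) {s t a : ℝ} (hsa : s ≤ a) (hat : a ≤ t) (x h : R3) :
    ‖∫ n : S2, (∫ r in s..t, (f (x + (a - r) • (n : R3)) - f (x + (a - r) • (n : R3) + h)))
      ∂sphereMeasure‖ ≤ C * (polarModulus h (a - s) + polarModulus h (t - a)) := by
  set F : R3 → 𝕜 := fun y => f (x + y) - f (x + y + h) with hF
  have hFm : StronglyMeasurable F :=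
    (hf.comp_measurable (by fun_prop)).sub (hf.comp_measurable (by fun_prop))
  have hFb : ∀ y, ‖F y‖ ≤ C + C := fun y => norm_sub_le_of_le (hb _) (hb _)
  have hFi : ∀ (n : S2) (p q : ℝ), IntervalIntegrable (fun r => F (r • (n : R3))) volume p q :=
    fun n => intervalIntegrable_of_bounded (hFm.comp_measurable (by fun_prop)) fun _ => hFb _
  have e : ∀ n : S2, ∫ r in s..t, F ((a - r) • (n : R3)) =
      (∫ r in (0 : ℝ)..(t - a), F (-(r • (n : R3)))) + ∫ r in (0 : ℝ)..(a - s), F (r • (n : R3)) := by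
    intro n
    rw [intervalIntegral.integral_comp_sub_left (fun r => F (r • (n : R3))),
      ← intervalIntegral.integral_add_adjacent_intervals (hFi n _ 0) (hFi n 0 _)]
    congr 1
    simp_rw [← neg_smul]
    rw [intervalIntegral.integral_comp_neg (fun r => F (r • (n : R3)))]
    simp
  have hm : ∀ {G : R3 → 𝕜}, StronglyMeasurable G → (∀ y, ‖G y‖ ≤ C + C) → ∀ b : ℝ,
      Integrable (fun n : S2 => ∫ r in (0 : ℝ)..b, G (r • (n : R3))) sphereMeasure := by
    intro G hG hGb b
    refine integrable_of_bounded (C := (C + C) * |b - 0|) ?_ ?_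
    · exact stronglyMeasurable_intervalIntegral (F := fun (n : S2) r => G (r • (n : R3)))
        (hG.comp_measurable (by fun_prop)) _ _
    · exact fun n => intervalIntegral.norm_integral_le_of_norm_le_const fun _ _ => hGb _
  have hFn : StronglyMeasurable fun y => F (-y) := hFm.comp_measurable measurable_neg
  change ‖∫ n : S2, (∫ r in s..t, F ((a - r) • (n : R3))) ∂sphereMeasure‖ ≤ _
  simp_rw [e]
  rw [integral_add (hm hFn (fun _ => hFb _) _) (hm hFm hFb _),
    integral_sphere_intervalIntegral_eq hFn (fun _ => hFb _) (by linarith),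
    integral_sphere_intervalIntegral_eq hFm hFb (by linarith)]
  -- The kernel is even, so the backward rays contribute an integral of the same form as the forward
  -- ones.
  have hneg : ∫ y, polarKernel (t - a) y • F (-y) = ∫ y, polarKernel (t - a) y • F y := by
    rw [← integral_neg_eq_self (fun y => polarKernel (t - a) y • F y)]
    simp only [polarKernel_neg]
  rw [hneg, mul_add, add_comm]
  exact norm_add_le_of_le
    (norm_integral_kernel_smul_sub_le hf hb (integrable_polarKernel _) x h)
    (norm_integral_kernel_smul_sub_le hf hb (integrable_polarKernel _) x h)

/-- The family of polar kernels with `0 < b < L`, as a function of `(b, y)`. -/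
def polarFamily (L : ℝ) (p : ℝ × R3) : ℝ := (Set.Ioo 0 L).indicator (fun b => polarKernel b p.2) p.1

/-- The kernels increase with `b`, so the family is dominated by the product of `1_{(0, L)}(b)` and
the kernel of radius `L`. -/
theorem integrable_polarFamily (L : ℝ) : Integrable (polarFamily L) (volume.prod volume) := by
  have h1 : Integrable (fun p : ℝ × R3 =>
      (Set.Ioo 0 L).indicator (fun _ => (1 : ℝ)) p.1 * polarKernel L p.2) (volume.prod volume) :=
    ((integrable_indicator_iff measurableSet_Ioo).2 (by simp)).mul_prod (integrable_polarKernel L)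
  refine h1.mono' ?_ (Eventually.of_forall fun p => ?_)
  · have : polarFamily L = (Prod.fst ⁻¹' Set.Ioo 0 L).indicator
        fun p : ℝ × R3 => polarKernel p.1 p.2 := by
      ext p; simp [polarFamily, Set.indicator]
    rw [this]
    exact (measurable_uncurry_polarKernel.indicator
      (measurableSet_Ioo.preimage measurable_fst)).aestronglyMeasurable
  · by_cases hp : p.1 ∈ Set.Ioo 0 L
    · simp only [polarFamily, Set.indicator_of_mem hp, one_mul,
        Real.norm_of_nonneg (polarKernel_nonneg _ _)]
      exact Set.indicator_le_indicator_of_subset (Metric.ball_subset_ball hp.2.le)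
        (fun _ => by positivity) _
    · simp [polarFamily, Set.indicator_of_notMem hp]

/-- By Fubini the moduli of all radii combine into one `L¹` modulus on `ℝ × ℝ³`, for translation in
the second variable only. A single application of `L¹` continuity then handles every radius at once.
-/
theorem intervalIntegrable_polarModulus {L : ℝ} (hL : 0 ≤ L) (h : R3) :
    IntervalIntegrable (polarModulus h) volume 0 L ∧
      ∫ b in (0 : ℝ)..L, polarModulus h b =
        ∫ p, ‖polarFamily L ((0, -h) + p) - polarFamily L p‖ ∂(volume.prod volume) := by
  have hi : Integrable (fun p : ℝ × R3 => ‖polarFamily L ((0, -h) + p) - polarFamily L p‖)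
      (volume.prod volume) :=
    (((integrable_polarFamily L).comp_add_left (0, -h)).sub (integrable_polarFamily L)).norm
  have e : (fun b => ∫ y, ‖polarFamily L ((0, -h) + (b, y)) - polarFamily L (b, y)‖) =
      (Set.Ioo 0 L).indicator (polarModulus h) := by
    ext b
    by_cases hb : b ∈ Set.Ioo 0 L <;>
      simp [polarFamily, polarModulus, Set.indicator_of_mem, hb, Set.indicator_of_notMem]
  have h1 := hi.integral_prod_left
  have h2 := integral_prod _ hi
  rw [e, integrable_indicator_iff measurableSet_Ioo] at h1
  rw [e, integral_indicator measurableSet_Ioo, ← integral_Ioc_eq_integral_Ioo,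
    ← intervalIntegral.integral_of_le hL] at h2
  refine ⟨?_, h2.symm⟩
  rw [intervalIntegrable_iff_integrableOn_Ioo_of_le hL]
  exact h1

theorem tendsto_integral_polarModulus {L : ℝ} (hL : 0 ≤ L) :
    Tendsto (fun h => ∫ b in (0 : ℝ)..L, polarModulus h b) (𝓝 0) (𝓝 0) := by
  have h1 := tendsto_integral_norm_translate_sub ((volume : Measure ℝ).prod (volume : Measure R3))
    (integrable_polarFamily L)
  have h2 : Tendsto (fun h : R3 => ((0 : ℝ), -h)) (𝓝 0) (𝓝 0) := by
    have : Continuous fun h : R3 => ((0 : ℝ), -h) := by fun_prop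
    simpa [← Prod.zero_eq_mk] using this.tendsto 0
  refine (h1.comp h2).congr fun h => ?_
  rw [(intervalIntegrable_polarModulus hL h).2]
  rfl

theorem energy_sub_le {L C : ℝ} (hL : 0 < L) {f : R3 → 𝕜} (hf : StronglyMeasurable f)
    (hper : CubePeriodic L f) (hb : ∀ x, ‖f x‖ ≤ C) {s t : ℝ} (hs : 0 ≤ s) (hst : s < t)
    (ht : t ≤ L / 2) (h : R3) :
    ∫ x in cube L, ∫ n, ‖lineInt f s t n x - lineInt f s t n (x + h)‖ ^ 2 ∂sphereMeasure ≤
      4 * volume.real (cube L) * C ^ 2 * ∫ b in (0 : ℝ)..L, polarModulus h b := by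
  have hC : 0 ≤ C := (norm_nonneg _).trans (hb 0)
  set g : R3 → 𝕜 := fun x => f x - f (x + h) with hg
  have hgm : StronglyMeasurable g := hf.sub (hf.comp_measurable (by fun_prop))
  have hgb : ∀ x, ‖g x‖ ≤ C + C := fun x => norm_sub_le_of_le (hb _) (hb _)
  have hgp : CubePeriodic L g := fun i x => by
    have := hper.comp_add h i x
    simp only [hg, hper i x] at this ⊢
    rw [this]
  have hline : ∀ n x, lineInt f s t n x - lineInt f s t n (x + h) = lineInt g s t n x := by
    intro n x
    have hi : ∀ z : R3, IntervalIntegrable (fun r : ℝ => f (z - r • (n : R3))) volume s t :=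
      fun z => intervalIntegrable_of_bounded (hf.comp_measurable (by fun_prop)) (fun _ => hb _) _ _
    unfold lineInt
    rw [← intervalIntegral.integral_sub (hi _) (hi _)]
    simp only [hg, add_sub_right_comm]
  simp_rw [hline]
  have hD : 0 ≤ ∫ x in cube L, ∫ n, ‖lineInt g s t n x‖ ^ 2 ∂sphereMeasure :=
    integral_nonneg fun x => integral_nonneg fun n => by positivity
  obtain ⟨hmi, -⟩ := intervalIntegrable_polarModulus hL.le h
  have hmi' : IntervalIntegrable (polarModulus h) volume 0 (t - s) :=
    hmi.mono_set (by
      rw [Set.uIcc_of_le hL.le, Set.uIcc_of_le (by linarith)]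
      exact Set.Icc_subset_Icc_right (by linarith))
  have hi1 : IntervalIntegrable (fun a => polarModulus h (a - s)) volume s t := by
    have := hmi'.comp_sub_right s
    simpa using this
  have hi2 : IntervalIntegrable (fun a => polarModulus h (t - a)) volume s t := by
    have := (hmi'.comp_sub_left t).symm
    simpa using this
  set V := volume.real (cube L)
  have hV0 : 0 ≤ V := measureReal_nonneg
  calc ∫ x in cube L, ∫ n, ‖lineInt g s t n x‖ ^ 2 ∂sphereMeasure
      = ‖((∫ x in cube L, ∫ n, ‖lineInt g s t n x‖ ^ 2 ∂sphereMeasure : ℝ) : 𝕜)‖ := by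
        rw [RCLike.norm_ofReal, abs_of_nonneg hD]
    -- The factor `C + C` bounds `g x`. Both radii sweep `[0, t - s]` as `a` varies, which doubles
    -- the integral and yields the constant `4`.
    _ ≤ ∫ a in s..t, ((C + C) * (C * (polarModulus h (a - s) + polarModulus h (t - a)))) * V := by
        rw [energy_eq hL hgm hgp hgb hst.le]
        refine intervalIntegral.norm_integral_le_of_norm_le hst.le
          (Eventually.of_forall fun a ha => ?_) ?_
        · refine norm_setIntegral_le_of_norm_le_const (volume_cube_lt_top L) fun x _ => ?_
          rw [norm_mul, RCLike.norm_conj]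
          exact mul_le_mul (hgb x) (norm_integral_sphere_sub_le hf hb ha.1.le ha.2 x h)
            (norm_nonneg _) (by linarith)
        · exact (((hi1.add hi2).const_mul C).const_mul (C + C)).mul_const V
    _ = 4 * V * C ^ 2 * ∫ b in (0 : ℝ)..(t - s), polarModulus h b := by
        rw [intervalIntegral.integral_mul_const, intervalIntegral.integral_const_mul,
          intervalIntegral.integral_const_mul, intervalIntegral.integral_add hi1 hi2,
          intervalIntegral.integral_comp_sub_right, intervalIntegral.integral_comp_sub_left]
        simp only [sub_self]
        ring
    -- Extending the nonnegative integrand to `[0, L]` removes the dependence on `s` and `t`.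
    _ ≤ 4 * V * C ^ 2 * ∫ b in (0 : ℝ)..L, polarModulus h b := by
        refine mul_le_mul_of_nonneg_left ?_ (by positivity)
        exact intervalIntegral.integral_mono_interval le_rfl (by linarith) (by linarith)
          (Eventually.of_forall fun b => polarModulus_nonneg h b) hmi

/-! ### Jensen's inequality, ball averages and a Kolmogorov–Riesz criterion -/

theorem norm_average_sq_le {α : Type*} [MeasurableSpace α] {μ : Measure α} [IsFiniteMeasure μ]
    [NeZero μ] {u : α → 𝕜} {C : ℝ} (hu : StronglyMeasurable u) (hb : ∀ x, ‖u x‖ ≤ C) :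
    ‖⨍ x, u x ∂μ‖ ^ 2 ≤ ⨍ x, ‖u x‖ ^ 2 ∂μ := by
  have hc : ConvexOn ℝ Set.univ fun z : 𝕜 => ‖z‖ ^ 2 :=
    convexOn_univ_norm.pow (fun z _ => norm_nonneg z) 2
  refine hc.map_average_le (by fun_prop) isClosed_univ (by simp)
    (integrable_of_bounded hu hb) (integrable_of_bounded (C := C ^ 2) (hu.norm.pow 2) fun x => ?_)
  simp only [Function.comp_apply, norm_pow, norm_norm]
  exact pow_le_pow_left₀ (norm_nonneg _) (hb x) 2

theorem L2_norm_sq_eq_integral {α : Type*} [MeasurableSpace α] {μ : Measure α} (u : Lp 𝕜 2 μ) :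
    ‖u‖ ^ 2 = ∫ x, ‖u x‖ ^ 2 ∂μ := by
  have h : ((‖u‖ ^ 2 : ℝ) : 𝕜) = ((∫ x, ‖u x‖ ^ 2 ∂μ : ℝ) : 𝕜) := by
    rw [← integral_ofReal]
    push_cast
    rw [← inner_self_eq_norm_sq_to_K (𝕜 := 𝕜), L2.inner_def]
    simp_rw [inner_self_eq_norm_sq_to_K]
  exact_mod_cast h

/-- The normalised indicator of the ball of radius `δ`. -/
def ballKernel (δ : ℝ) : R3 → ℝ :=
  (Metric.ball 0 δ).indicator fun _ => (volume.real (Metric.ball (0 : R3) δ))⁻¹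

/-- The average of `f` over the balls of radius `δ`. -/
def ballAverage (δ : ℝ) (f : R3 → 𝕜) (x : R3) : 𝕜 :=
  ⨍ y in Metric.ball 0 δ, f (x + y)

theorem integrable_ballKernel (δ : ℝ) : Integrable (ballKernel δ) volume :=
  (integrable_indicator_iff Metric.isOpen_ball.measurableSet).2
    (integrableOn_const Metric.isBounded_ball.measure_lt_top.ne)

theorem ballAverage_eq (δ : ℝ) (f : R3 → 𝕜) (x : R3) :
    ballAverage δ f x = ∫ y, ballKernel δ y • f (x + y) := by
  rw [ballAverage, setAverage_eq, ← integral_smul,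
    ← integral_indicator Metric.isOpen_ball.measurableSet]
  refine integral_congr_ae (Eventually.of_forall fun y => ?_)
  simp only [ballKernel, Set.indicator]
  split_ifs <;> simp

theorem stronglyMeasurable_ballAverage {f : R3 → 𝕜} (hf : StronglyMeasurable f) (δ : ℝ) :
    StronglyMeasurable (ballAverage δ f) := by
  unfold ballAverage average
  exact StronglyMeasurable.integral_prod_right (f := fun x y => f (x + y))
    (hf.comp_measurable (by fun_prop : Measurable fun p : R3 × R3 => p.1 + p.2))

instance neZero_restrict_ball {δ : ℝ} [Fact (0 < δ)] :
    NeZero (volume.restrict (Metric.ball (0 : R3) δ)) :=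
  ⟨by simpa using! (Metric.measure_ball_pos volume (0 : R3) (Fact.out : 0 < δ)).ne'⟩

instance isFiniteMeasure_restrict_ball {δ : ℝ} :
    IsFiniteMeasure (volume.restrict (Metric.ball (0 : R3) δ)) :=
  ⟨by simpa using (measure_ball_lt_top : volume (Metric.ball (0 : R3) δ) < ∞)⟩

theorem norm_average_le_of_bounded {α : Type*} [MeasurableSpace α] {μ : Measure α}
    [IsFiniteMeasure μ] [NeZero μ] {u : α → 𝕜} {C : ℝ} (hb : ∀ x, ‖u x‖ ≤ C) :
    ‖⨍ x, u x ∂μ‖ ≤ C := by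
  unfold average
  refine (norm_integral_le_of_norm_le_const (Eventually.of_forall hb)).trans ?_
  simp

theorem norm_ballAverage_le {f : R3 → 𝕜} {C : ℝ} (hb : ∀ x, ‖f x‖ ≤ C) {δ : ℝ} (hδ : 0 < δ)
    (x : R3) : ‖ballAverage δ f x‖ ≤ C := by
  have := Fact.mk hδ
  exact norm_average_le_of_bounded fun _ => hb _

/-- Equicontinuity: for fixed `δ` the modulus depends on `f` only through its bound `C`. -/
theorem norm_ballAverage_sub_le {f : R3 → 𝕜} {C : ℝ} (hf : StronglyMeasurable f)
    (hb : ∀ x, ‖f x‖ ≤ C) (δ : ℝ) (x h : R3) :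
    ‖ballAverage δ f x - ballAverage δ f (x + h)‖ ≤
      C * ∫ y, ‖ballKernel δ (-h + y) - ballKernel δ y‖ := by
  have hi : ∀ z : R3, Integrable (fun y => ballKernel δ y • f (z + y)) volume := fun z =>
    (integrable_ballKernel δ).smul_bdd C
      (hf.comp_measurable (by fun_prop)).aestronglyMeasurable (Eventually.of_forall fun _ => hb _)
  rw [ballAverage_eq, ballAverage_eq, ← integral_sub (hi _) (hi _)]
  simp_rw [← smul_sub, add_right_comm x h]
  exact norm_integral_kernel_smul_sub_le hf hb (integrable_ballKernel δ) x h

/-- By Jensen and Fubini the left side is at most the mean over `‖y‖ < δ` of the translation errors,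
each at most `e`. -/
theorem integral_norm_sub_ballAverage_sq_le {A : Set R3} (hA : volume A < ∞) {f : R3 → 𝕜} {C e : ℝ}
    (hf : StronglyMeasurable f) (hb : ∀ x, ‖f x‖ ≤ C) {δ : ℝ} (hδ : 0 < δ)
    (he : ∀ h : R3, ‖h‖ < δ → ∫ x in A, ‖f x - f (x + h)‖ ^ 2 ≤ e) :
    ∫ x in A, ‖f x - ballAverage δ f x‖ ^ 2 ≤ e := by
  have := Fact.mk hδ
  have : IsFiniteMeasure (volume.restrict A) := ⟨by simpa using hA⟩
  have hm2 : StronglyMeasurable fun p : R3 × R3 => ‖f p.1 - f (p.1 + p.2)‖ ^ 2 :=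
    ((hf.comp_measurable measurable_fst).sub (hf.comp_measurable (by fun_prop))).norm.pow 2
  have hb2 : ∀ x y, ‖‖f x - f (x + y)‖ ^ 2‖ ≤ (C + C) ^ 2 := fun x y => by
    rw [norm_pow, norm_norm]
    exact pow_le_pow_left₀ (norm_nonneg _) (norm_sub_le_of_le (hb _) (hb _)) 2
  have hm1 : ∀ x : R3, StronglyMeasurable fun y => f (x + y) := fun x =>
    hf.comp_measurable (by fun_prop)
  have hpt : ∀ x, ‖f x - ballAverage δ f x‖ ^ 2 ≤
      ⨍ y in Metric.ball 0 δ, ‖f x - f (x + y)‖ ^ 2 := by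
    intro x
    have e1 : f x - ballAverage δ f x = ⨍ y in Metric.ball 0 δ, (f x - f (x + y)) := by
      have h1 : ⨍ y in Metric.ball (0 : R3) δ, f x = f x := average_const _ _
      conv_lhs => rw [← h1]
      unfold ballAverage average
      rw [integral_sub (integrable_const _) (integrable_of_bounded (hm1 x) fun _ => hb _)]
    rw [e1]
    exact norm_average_sq_le (C := C + C) (stronglyMeasurable_const.sub (hm1 x))
      fun _ => norm_sub_le_of_le (hb _) (hb _)
  calc ∫ x in A, ‖f x - ballAverage δ f x‖ ^ 2
      ≤ ∫ x in A, ⨍ y in Metric.ball 0 δ, ‖f x - f (x + y)‖ ^ 2 := by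
        refine integral_mono ?_ ?_ hpt
        · refine integrable_of_bounded (C := (C + C) ^ 2)
            ((hf.sub (stronglyMeasurable_ballAverage hf δ)).norm.pow 2) fun x => ?_
          rw [norm_pow, norm_norm]
          exact pow_le_pow_left₀ (norm_nonneg _)
            (norm_sub_le_of_le (hb _) (norm_ballAverage_le hb hδ _)) 2
        · refine integrable_of_bounded (C := (C + C) ^ 2) ?_ fun x =>
            norm_average_le_of_bounded (hb2 x)
          unfold average
          exact StronglyMeasurable.integral_prod_right (f := fun x y => ‖f x - f (x + y)‖ ^ 2) hm2
    _ = ⨍ y in Metric.ball 0 δ, ∫ x in A, ‖f x - f (x + y)‖ ^ 2 := by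
        unfold average
        exact integral_integral_swap_of_bounded hm2 hb2
    _ ≤ e := by
        have h1 : ⨍ y in Metric.ball (0 : R3) δ, e = e := average_const _ _
        rw [← h1, setAverage_eq, setAverage_eq]
        refine smul_le_smul_of_nonneg_left ?_ (by positivity)
        refine setIntegral_mono_on ?_ (integrable_const _) Metric.isOpen_ball.measurableSet
          fun y hy => he y (by simpa using hy)
        exact (integrable_of_bounded (μ := (volume.restrict A).prod
          (volume.restrict (Metric.ball (0 : R3) δ))) hm2 fun p => hb2 p.1 p.2).integral_prod_right

theorem norm_sub_sq_le_three (a b c d : 𝕜) :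
    ‖a - d‖ ^ 2 ≤ 3 * (‖a - b‖ ^ 2 + ‖b - c‖ ^ 2 + ‖d - c‖ ^ 2) := by
  have h : ‖a - d‖ ≤ ‖a - b‖ + ‖b - c‖ + ‖d - c‖ := by
    rw [norm_sub_rev d c]
    calc ‖a - d‖ = ‖(a - b) + (b - c) + (c - d)‖ := by congr 1; ring
      _ ≤ _ := norm_add₃_le
  have h2 := pow_le_pow_left₀ (norm_nonneg _) h 2
  nlinarith [sq_nonneg (‖a - b‖ - ‖b - c‖), sq_nonneg (‖a - b‖ - ‖d - c‖),
    sq_nonneg (‖b - c‖ - ‖d - c‖)]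

/-- A Kolmogorov–Riesz criterion: a uniformly bounded family of functions on `ℝ³` with uniformly
small translates in the mean is relatively compact in `L²` of any compact set. -/
theorem isCompact_closure_L2_of_translates {A : Set R3} (hA : IsCompact A) {S : Set (R3 → 𝕜)}
    {C : ℝ} (hm : ∀ f ∈ S, StronglyMeasurable f) (hb : ∀ f ∈ S, ∀ x, ‖f x‖ ≤ C)
    (he : ∀ e : ℝ, 0 < e → ∃ h₀ : ℝ, 0 < h₀ ∧ ∀ h : R3, ‖h‖ < h₀ → ∀ f ∈ S,
      ∫ x in A, ‖f x - f (x + h)‖ ^ 2 ≤ e) :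
    IsCompact (closure {g : Lp 𝕜 2 (volume.restrict A) |
      ∃ f ∈ S, g =ᵐ[volume.restrict A] f}) := by
  refine (TotallyBounded.closure ?_).isCompact_of_isClosed isClosed_closure
  -- Each element gets a code from a finite set: the approximate values of its ball average on a
  -- finite net of `A`. Equal codes must force distance below `ε`.
  refine Metric.totallyBounded_of_finite_discretization fun ε hε => ?_
  have hfin : IsFiniteMeasure (volume.restrict A) := ⟨by simpa using hA.measure_lt_top⟩
  set V := volume.real A
  have hV0 : 0 ≤ V := measureReal_nonneg
  -- Here `27 = 3 · 3²`: a factor `3` from `norm_sub_sq_le_three`, and ball averages with equal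
  -- codes differ by at most `3η`. The two smoothing errors take the other `ε² / 2`, as `3 · ε² /
  -- 12` each.
  obtain ⟨η, hη, hηV⟩ : ∃ η : ℝ, 0 < η ∧ 27 * V * η ^ 2 < ε ^ 2 / 2 := by
    have hc : Continuous fun η : ℝ => 27 * V * η ^ 2 := by fun_prop
    have h1 : ∀ᶠ η : ℝ in 𝓝[>] 0, 27 * V * η ^ 2 < ε ^ 2 / 2 :=
      ((hc.tendsto 0).mono_left nhdsWithin_le_nhds).eventually_lt_const (by simp; positivity)
    obtain ⟨η, h1, h2⟩ := (h1.and self_mem_nhdsWithin).exists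
    exact ⟨η, h2, h1⟩
  obtain ⟨δ, hδ, hδe⟩ := he (ε ^ 2 / 12) (by positivity)
  obtain ⟨ρ, hρ, hρe⟩ : ∃ ρ : ℝ, 0 < ρ ∧ ∀ f ∈ S, ∀ x z : R3, dist x z < ρ →
      ‖ballAverage δ f x - ballAverage δ f z‖ ≤ η := by
    have ht := (tendsto_integral_norm_translate_sub (volume : Measure R3)
      (integrable_ballKernel δ)).const_mul C
    rw [mul_zero] at ht
    obtain ⟨ρ, hρ, h⟩ := Metric.eventually_nhds_iff.1 (ht.eventually_le_const hη)
    refine ⟨ρ, hρ, fun f hf x z hxz => ?_⟩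
    have h1 := norm_ballAverage_sub_le (hm f hf) (hb f hf) δ x (z - x)
    rw [add_sub_cancel] at h1
    exact h1.trans (h (by rwa [dist_zero_right, neg_sub, ← dist_eq_norm]))
  obtain ⟨T, -, hTf, hT⟩ := hA.finite_cover_balls hρ
  obtain ⟨W, -, hWf, hW⟩ := (isCompact_closedBall (0 : 𝕜) C).finite_cover_balls (half_pos hη)
  have hw : ∀ (f : S) (z : T), ∃ w : W, ‖ballAverage δ f.1 z - w‖ < η / 2 := by
    intro f z
    have := hW (mem_closedBall_zero_iff.2 (norm_ballAverage_le (hb f.1 f.2) hδ z))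
    simp only [Set.mem_iUnion, exists_prop, Metric.mem_ball, dist_eq_norm] at this
    obtain ⟨w, hw, h⟩ := this
    exact ⟨⟨w, hw⟩, h⟩
  choose w hw using hw
  have hrep : ∀ g : {g : Lp 𝕜 2 (volume.restrict A) | ∃ f ∈ S, g =ᵐ[volume.restrict A] f},
      ∃ f : S, g.1 =ᵐ[volume.restrict A] f.1 := by
    rintro ⟨g, f, hf, hgf⟩
    exact ⟨⟨f, hf⟩, hgf⟩
  choose r hr using hrep
  have := hTf.fintype
  have := hWf.fintype
  classical
  refine ⟨T → W, inferInstance, fun g => w (r g), fun g g' hgg => ?_⟩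
  set f := (r g).1
  set f' := (r g').1
  have hclose : ∀ x ∈ A, ‖ballAverage δ f x - ballAverage δ f' x‖ ≤ 3 * η := by
    intro x hx
    have := hT hx
    simp only [Set.mem_iUnion, exists_prop, Metric.mem_ball] at this
    obtain ⟨z, hz, hxz⟩ := this
    have h1 := hρe f (r g).2 x z hxz
    have h2 := hρe f' (r g').2 x z hxz
    have h3 := hw (r g) ⟨z, hz⟩
    have h4 := hw (r g') ⟨z, hz⟩
    have h5 : w (r g) ⟨z, hz⟩ = w (r g') ⟨z, hz⟩ := congrFun hgg _
    rw [h5] at h3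
    rw [norm_sub_rev] at h2 h4
    calc ‖ballAverage δ f x - ballAverage δ f' x‖
        = ‖(ballAverage δ f x - ballAverage δ f z) +
            ((ballAverage δ f z - w (r g') ⟨z, hz⟩) + (w (r g') ⟨z, hz⟩ - ballAverage δ f' z)) +
            (ballAverage δ f' z - ballAverage δ f' x)‖ := by congr 1; ring
      _ ≤ η + (η / 2 + η / 2) + η :=
        norm_add₃_le.trans (add_le_add (add_le_add h1 (norm_add_le_of_le h3.le h4.le)) h2)
      _ = 3 * η := by ring
  have hI : ∀ {u v : R3 → 𝕜}, StronglyMeasurable u → StronglyMeasurable v → (∀ x, ‖u x‖ ≤ C) →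
      (∀ x, ‖v x‖ ≤ C) → Integrable (fun x => ‖u x - v x‖ ^ 2) (volume.restrict A) := by
    intro u v hu hv hub hvb
    refine integrable_of_bounded (C := (C + C) ^ 2) ((hu.sub hv).norm.pow 2) fun x => ?_
    rw [norm_pow, norm_norm]
    exact pow_le_pow_left₀ (norm_nonneg _) (norm_sub_le_of_le (hub _) (hvb _)) 2
  have hfm := hm f (r g).2
  have hfm' := hm f' (r g').2
  have hfb := hb f (r g).2
  have hfb' := hb f' (r g').2
  have hAm := stronglyMeasurable_ballAverage hfm δ
  have hAm' := stronglyMeasurable_ballAverage hfm' δ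
  have hAb := norm_ballAverage_le hfb hδ
  have hAb' := norm_ballAverage_le hfb' hδ
  have hmain : ∫ x in A, ‖f x - f' x‖ ^ 2 < ε ^ 2 := by
    calc ∫ x in A, ‖f x - f' x‖ ^ 2
        ≤ ∫ x in A, 3 * (‖f x - ballAverage δ f x‖ ^ 2 +
            ‖ballAverage δ f x - ballAverage δ f' x‖ ^ 2 + ‖f' x - ballAverage δ f' x‖ ^ 2) :=
          integral_mono (hI hfm hfm' hfb hfb')
            ((((hI hfm hAm hfb hAb).add (hI hAm hAm' hAb hAb')).add
              (hI hfm' hAm' hfb' hAb')).const_mul 3) fun x => norm_sub_sq_le_three _ _ _ _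
      _ = 3 * (∫ x in A, ‖f x - ballAverage δ f x‖ ^ 2) +
            3 * (∫ x in A, ‖ballAverage δ f x - ballAverage δ f' x‖ ^ 2) +
            3 * ∫ x in A, ‖f' x - ballAverage δ f' x‖ ^ 2 := by
          have h12 := integral_add (hI hfm hAm hfb hAb) (hI hAm hAm' hAb hAb')
          have h123 := integral_add ((hI hfm hAm hfb hAb).add (hI hAm hAm' hAb hAb'))
            (hI hfm' hAm' hfb' hAb')
          simp only [Pi.add_apply] at h123
          rw [integral_const_mul, h123, h12]
          ring
      _ ≤ 3 * (ε ^ 2 / 12) + 3 * ((3 * η) ^ 2 * V) + 3 * (ε ^ 2 / 12) := by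
          gcongr
          · exact integral_norm_sub_ballAverage_sq_le hA.measure_lt_top hfm hfb hδ
              fun h hh => hδe h hh f (r g).2
          · refine (Real.le_norm_self _).trans
              (norm_setIntegral_le_of_norm_le_const hA.measure_lt_top fun x hx => ?_)
            rw [norm_pow, norm_norm]
            exact pow_le_pow_left₀ (norm_nonneg _) (hclose x hx) 2
          · exact integral_norm_sub_ballAverage_sq_le hA.measure_lt_top hfm' hfb' hδ
              fun h hh => hδe h hh f' (r g').2
      _ < ε ^ 2 := by nlinarith
  rw [dist_eq_norm]
  refine lt_of_pow_lt_pow_left₀ 2 hε.le ?_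
  rw [L2_norm_sq_eq_integral]
  refine lt_of_eq_of_lt (integral_congr_ae ?_) hmain
  filter_upwards [Lp.coeFn_sub g.1 g'.1, hr g, hr g'] with x h1 h2 h3
  rw [h1, Pi.sub_apply, h2, h3]

/-! ### Bounds and translation estimates for the power averages -/

/-- Factor `a ^ m - b ^ m` through the geometric sum. For `m = 0` the truncated exponent `m - 1` is
harmless, since both sides vanish. -/
theorem norm_pow_sub_pow_le_mul {a b : 𝕜} {B : ℝ} (ha : ‖a‖ ≤ B) (hb : ‖b‖ ≤ B) (m : ℕ) :
    ‖a ^ m - b ^ m‖ ≤ m * B ^ (m - 1) * ‖a - b‖ := by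
  have hB : 0 ≤ B := (norm_nonneg _).trans ha
  rw [← (Commute.all a b).geom_sum₂_mul, norm_mul]
  refine mul_le_mul_of_nonneg_right ?_ (norm_nonneg _)
  refine (norm_sum_le _ _).trans ?_
  calc ∑ i ∈ Finset.range m, ‖a ^ i * b ^ (m - 1 - i)‖
      ≤ ∑ i ∈ Finset.range m, B ^ (m - 1) := by
        refine Finset.sum_le_sum fun i hi => ?_
        have hi' : i + (m - 1 - i) = m - 1 := by
          have := Finset.mem_range.1 hi
          omega
        rw [norm_mul, norm_pow, norm_pow, ← hi', pow_add, hi']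
        gcongr
    _ = m * B ^ (m - 1) := by simp

section Bounded

variable {f : R3 → 𝕜} {C L s t : ℝ}

theorem norm_lineInt_le_mul_side (hb : ∀ x, ‖f x‖ ≤ C) (hs : 0 ≤ s) (hst : s < t)
    (ht : t ≤ L / 2) (n : S2) (x : R3) : ‖lineInt f s t n x‖ ≤ C * L := by
  refine (norm_lineInt_le hb s t n x).trans (mul_le_mul_of_nonneg_left ?_
    ((norm_nonneg _).trans (hb 0)))
  rw [abs_of_pos (by linarith)]
  linarith

theorem stronglyMeasurable_lineInt_right (hf : StronglyMeasurable f) (s t : ℝ) (x : R3) :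
    StronglyMeasurable fun n : S2 => lineInt f s t n x :=
  (stronglyMeasurable_lineInt hf s t).comp_measurable
    (by fun_prop : Measurable fun n : S2 => (x, n))

theorem stronglyMeasurable_lineInt_sub (hf : StronglyMeasurable f) (s t : ℝ) (h : R3) :
    StronglyMeasurable fun p : R3 × S2 => lineInt f s t p.2 p.1 - lineInt f s t p.2 (p.1 + h) :=
  (stronglyMeasurable_lineInt hf s t).sub ((stronglyMeasurable_lineInt hf s t).comp_measurable
    (by fun_prop : Measurable fun p : R3 × S2 => (p.1 + h, p.2)))

theorem stronglyMeasurable_powerAvg (hf : StronglyMeasurable f) (m : ℕ) (s t : ℝ) :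
    StronglyMeasurable (powerAvg f m s t) := by
  unfold powerAvg average
  exact StronglyMeasurable.integral_prod_right (f := fun x n => lineInt f s t n x ^ m)
    ((stronglyMeasurable_lineInt hf s t).pow m)

theorem norm_powerAvg_le (hb : ∀ x, ‖f x‖ ≤ C) (hs : 0 ≤ s) (hst : s < t)
    (ht : t ≤ L / 2) (m : ℕ) (x : R3) : ‖powerAvg f m s t x‖ ≤ (C * L) ^ m := by
  refine norm_average_le_of_bounded fun n => ?_
  rw [norm_pow]
  exact pow_le_pow_left₀ (norm_nonneg _) (norm_lineInt_le_mul_side hb hs hst ht n x) m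

theorem integrable_average_norm_lineInt_sub_sq (hf : StronglyMeasurable f)
    (hb : ∀ x, ‖f x‖ ≤ C) (hs : 0 ≤ s) (hst : s < t) (ht : t ≤ L / 2) (h : R3) :
    Integrable (fun x => ⨍ n, ‖lineInt f s t n x - lineInt f s t n (x + h)‖ ^ 2 ∂sphereMeasure)
      (volume.restrict (cube L)) := by
  have hB := norm_lineInt_le_mul_side hb hs hst ht
  refine integrable_of_bounded (C := (C * L + C * L) ^ 2) ?_ fun x =>
    norm_average_le_of_bounded fun n => ?_
  · unfold average
    exact StronglyMeasurable.integral_prod_right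
      (f := fun x n => ‖lineInt f s t n x - lineInt f s t n (x + h)‖ ^ 2)
      ((stronglyMeasurable_lineInt_sub hf s t h).norm.pow 2)
  · rw [norm_pow, norm_norm]
    exact pow_le_pow_left₀ (norm_nonneg _) (norm_sub_le_of_le (hB _ _) (hB _ _)) 2

theorem integral_norm_average_lineInt_sub_sq_le (hf : StronglyMeasurable f)
    (hb : ∀ x, ‖f x‖ ≤ C) (hs : 0 ≤ s) (hst : s < t) (ht : t ≤ L / 2) (h : R3) :
    ∫ x in cube L,
        ‖⨍ n, (lineInt f s t n x - lineInt f s t n (x + h)) ∂sphereMeasure‖ ^ 2 ≤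
      ∫ x in cube L,
        ⨍ n, ‖lineInt f s t n x - lineInt f s t n (x + h)‖ ^ 2 ∂sphereMeasure := by
  have hB := norm_lineInt_le_mul_side hb hs hst ht
  refine integral_mono_of_nonneg (Eventually.of_forall fun x => by positivity)
    (integrable_average_norm_lineInt_sub_sq hf hb hs hst ht h)
    (Eventually.of_forall fun x => ?_)
  exact norm_average_sq_le (C := C * L + C * L) ((stronglyMeasurable_lineInt_sub hf s t
    h).comp_measurable (by fun_prop : Measurable fun n : S2 => (x, n)))
    fun n => norm_sub_le_of_le (hB _ _) (hB _ _)

theorem integral_average_norm_lineInt_sub_sq_le (hL : 0 < L) (hf : StronglyMeasurable f)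
    (hper : CubePeriodic L f) (hb : ∀ x, ‖f x‖ ≤ C) (hs : 0 ≤ s) (hst : s < t)
    (ht : t ≤ L / 2) (h : R3) :
    ∫ x in cube L, ⨍ n, ‖lineInt f s t n x - lineInt f s t n (x + h)‖ ^ 2 ∂sphereMeasure ≤
      (sphereMeasure.real Set.univ)⁻¹ * (4 * volume.real (cube L) * C ^ 2) *
        ∫ b in (0 : ℝ)..L, polarModulus h b := by
  simp_rw [average_eq, smul_eq_mul]
  rw [integral_const_mul, mul_assoc]
  exact mul_le_mul_of_nonneg_left (energy_sub_le hL hf hper hb hs hst ht h) (by positivity)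

/-- Jensen brings the square inside the spherical mean, where `z ↦ z ^ m` is Lipschitz on the ball
of radius `C * L` containing all the line integrals. -/
theorem integral_norm_powerAvg_sub_sq_le (hf : StronglyMeasurable f)
    (hb : ∀ x, ‖f x‖ ≤ C) (hs : 0 ≤ s) (hst : s < t) (ht : t ≤ L / 2) (m : ℕ) (h : R3) :
    ∫ x in cube L, ‖powerAvg f m s t x - powerAvg f m s t (x + h)‖ ^ 2 ≤
      (m * (C * L) ^ (m - 1)) ^ 2 * ∫ x in cube L,
        ⨍ n, ‖lineInt f s t n x - lineInt f s t n (x + h)‖ ^ 2 ∂sphereMeasure := by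
  have hB := norm_lineInt_le_mul_side hb hs hst ht
  have hBm : ∀ n x, ‖lineInt f s t n x ^ m‖ ≤ (C * L) ^ m := fun n x => by
    rw [norm_pow]
    exact pow_le_pow_left₀ (norm_nonneg _) (hB n x) m
  have hm := stronglyMeasurable_lineInt_right hf s t
  rw [← integral_const_mul]
  refine integral_mono_of_nonneg (Eventually.of_forall fun x => by positivity)
    ((integrable_average_norm_lineInt_sub_sq hf hb hs hst ht h).const_mul _)
    (Eventually.of_forall fun x => ?_)
  dsimp only
  have e : powerAvg f m s t x - powerAvg f m s t (x + h) =
      ⨍ n, (lineInt f s t n x ^ m - lineInt f s t n (x + h) ^ m) ∂sphereMeasure := by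
    unfold powerAvg average
    exact (integral_sub (f := fun n => lineInt f s t n x ^ m)
      (g := fun n => lineInt f s t n (x + h) ^ m)
      (integrable_of_bounded ((hm x).pow m) fun n => hBm n _)
      (integrable_of_bounded ((hm _).pow m) fun n => hBm n _)).symm
  rw [e]
  refine (norm_average_sq_le (C := (C * L) ^ m + (C * L) ^ m) (((hm x).pow m).sub ((hm _).pow m))
    fun n => norm_sub_le_of_le (hBm _ _) (hBm _ _)).trans ?_
  unfold average
  rw [← integral_const_mul]
  refine integral_mono_of_nonneg (Eventually.of_forall fun n => by positivity)
    (Integrable.const_mul (integrable_of_bounded (C := (C * L + C * L) ^ 2)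
      (((hm x).sub (hm _)).norm.pow 2) fun n => ?_) _) (Eventually.of_forall fun n => ?_)
  · simp only [Pi.pow_apply, norm_pow, norm_norm]
    exact pow_le_pow_left₀ (norm_nonneg _) (norm_sub_le_of_le (hB _ _) (hB _ _)) 2
  · dsimp only
    rw [← mul_pow]
    exact pow_le_pow_left₀ (norm_nonneg _) (norm_pow_sub_pow_le_mul (hB _ _) (hB _ _) m) 2

end Bounded

/-! ### Passage from representatives back to the given functions -/

theorem ae_ae_lineInt_eq {f g : R3 → 𝕜} (hfg : f =ᵐ[volume] g) (s t : ℝ) (h : R3) :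
    ∀ᵐ x : R3, ∀ᵐ n ∂sphereMeasure, lineInt f s t n (x + h) = lineInt g s t n (x + h) :=
  (measurePreserving_add_right volume h).quasiMeasurePreserving.ae
    (Measure.ae_ae_of_ae_prod (lineInt_ae_eq hfg s t))

theorem average_congr_ae {α E : Type*} [MeasurableSpace α] {μ : Measure α} [NormedAddCommGroup E]
    [NormedSpace ℝ E] {u v : α → E} (h : u =ᵐ[μ] v) : ⨍ x, u x ∂μ = ⨍ x, v x ∂μ := by
  rw [average_eq, average_eq, integral_congr_ae h]

theorem powerAvg_ae_eq {f g : R3 → 𝕜} (hfg : f =ᵐ[volume] g) (m : ℕ) (s t : ℝ) :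
    powerAvg f m s t =ᵐ[volume] powerAvg g m s t := by
  filter_upwards [ae_ae_lineInt_eq hfg s t 0] with x hx
  simp only [add_zero] at hx
  exact average_congr_ae (hx.mono fun n hn => by simp only [hn])

end LineAvg

end

/-- The first conclusion says that the line integrals are honest: they exist for almost every
`(x, n)` and are measurable and essentially bounded in `(x, n)`, so that none of the Bochner
integrals in the other conclusions takes a default value except on null sets of `x`. -/
theorem mainTheorem6 {𝕜 : Type*} [RCLike 𝕜] (L : ℝ) (hL : 0 < L) (M : ℝ)
    (φ : ℕ → LineAvg.R3 → 𝕜)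
    (hper : ∀ j, LineAvg.CubePeriodic L (φ j))
    (hmem : ∀ j, MemLp (φ j) ∞ (volume.restrict (LineAvg.cube L)))
    (hbound : ∀ j, eLpNorm (φ j) ∞ (volume.restrict (LineAvg.cube L)) ≤ ENNReal.ofReal M) :
    (∀ (j : ℕ) (s t : ℝ), 0 ≤ s → s < t → t ≤ L / 2 →
      (∀ᵐ p : LineAvg.R3 × LineAvg.S2 ∂(volume.prod LineAvg.sphereMeasure),
        IntervalIntegrable (fun r : ℝ => φ j (p.1 - r • (p.2 : LineAvg.R3))) volume s t) ∧
      MemLp (fun p : LineAvg.R3 × LineAvg.S2 => LineAvg.lineInt (φ j) s t p.2 p.1) ∞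
        (volume.prod LineAvg.sphereMeasure)) ∧
    (∀ ε : ℝ, 0 < ε → ∃ h₀ : ℝ, 0 < h₀ ∧
      ∀ h : LineAvg.R3, ‖h‖ < h₀ → ∀ (j : ℕ) (s t : ℝ), 0 ≤ s → s < t → t ≤ L / 2 →
        (∫ x in LineAvg.cube L,
            ‖⨍ n, (LineAvg.lineInt (φ j) s t n x - LineAvg.lineInt (φ j) s t n (x + h))
              ∂LineAvg.sphereMeasure‖ ^ 2
          ≤ ∫ x in LineAvg.cube L,
            ⨍ n, ‖LineAvg.lineInt (φ j) s t n x - LineAvg.lineInt (φ j) s t n (x + h)‖ ^ 2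
              ∂LineAvg.sphereMeasure) ∧
        ∫ x in LineAvg.cube L,
            ⨍ n, ‖LineAvg.lineInt (φ j) s t n x - LineAvg.lineInt (φ j) s t n (x + h)‖ ^ 2
              ∂LineAvg.sphereMeasure < ε) ∧
    (∀ m : ℕ,
      (∀ (j : ℕ) (s t : ℝ), 0 ≤ s → s < t → t ≤ L / 2 →
        MemLp (LineAvg.powerAvg (φ j) m s t) 2 (volume.restrict (LineAvg.cube L))) ∧
      IsCompact (closure {g : Lp 𝕜 2 (volume.restrict (LineAvg.cube L)) |
        ∃ (j : ℕ) (s t : ℝ), 0 ≤ s ∧ s < t ∧ t ≤ L / 2 ∧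
          g =ᵐ[volume.restrict (LineAvg.cube L)] LineAvg.powerAvg (φ j) m s t})) := by
  -- The sign of `M` is not prescribed, while the pointwise bound on the representatives needs a
  -- nonnegative constant.
  set C : ℝ := max M 0
  have hC : 0 ≤ C := le_max_right _ _
  have hrep := fun j => (hper j).exists_bounded_representative hL hC (hmem j).aestronglyMeasurable
    ((hbound j).trans (ENNReal.ofReal_le_ofReal (le_max_left M 0)))
  choose ψ hψm hψp hψb hψ using hrep
  -- A single `h₀` serves all `j, s, t`, because the bound involves only `L`, `C` and `h`.
  have hsmall : ∀ ε : ℝ, 0 < ε → ∃ h₀ : ℝ, 0 < h₀ ∧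
      ∀ h : LineAvg.R3, ‖h‖ < h₀ → ∀ (j : ℕ) (s t : ℝ), 0 ≤ s → s < t → t ≤ L / 2 →
        ∫ x in LineAvg.cube L,
            ⨍ n, ‖LineAvg.lineInt (ψ j) s t n x - LineAvg.lineInt (ψ j) s t n (x + h)‖ ^ 2
              ∂LineAvg.sphereMeasure < ε := by
    intro ε hε
    have ht := (LineAvg.tendsto_integral_polarModulus hL.le).const_mul
      ((LineAvg.sphereMeasure.real Set.univ)⁻¹ * (4 * volume.real (LineAvg.cube L) * C ^ 2))
    rw [mul_zero] at ht
    obtain ⟨h₀, h₀pos, hh⟩ := Metric.eventually_nhds_iff.1 (ht.eventually_lt_const hε)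
    exact ⟨h₀, h₀pos, fun h hlt j s t hs hst htL =>
      (LineAvg.integral_average_norm_lineInt_sub_sq_le hL (hψm j) (hψp j) (hψb j) hs hst htL
        h).trans_lt (hh (by rwa [dist_zero_right]))⟩
  refine ⟨fun j s t hs hst ht => ⟨?_, ?_⟩, fun ε hε => ?_, fun m => ⟨fun j s t hs hst ht => ?_, ?_⟩⟩
  · filter_upwards [LineAvg.ae_ae_eq_sub_smul (hψ j)] with p hp
    have hmeas : Measurable fun r : ℝ => p.1 - r • (p.2 : LineAvg.R3) := by fun_prop
    refine (LineAvg.intervalIntegrable_of_bounded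
      ((hψm j).comp_measurable hmeas) (fun _ => hψb j _) s t).congr_ae ?_
    exact ae_restrict_of_ae (hp.mono fun r hr => hr.symm)
  · have h1 : MemLp (fun p : LineAvg.R3 × LineAvg.S2 => LineAvg.lineInt (ψ j) s t p.2 p.1) ∞
        (volume.prod LineAvg.sphereMeasure) :=
      memLp_top_of_bound (LineAvg.stronglyMeasurable_lineInt (hψm j) s t).aestronglyMeasurable
        (C * L) (Filter.Eventually.of_forall fun p =>
          LineAvg.norm_lineInt_le_mul_side (hψb j) hs hst ht p.2 p.1)
    exact h1.ae_eq ((LineAvg.lineInt_ae_eq (hψ j) s t).mono fun p hp => hp.symm)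
  · obtain ⟨h₀, h₀pos, hh⟩ := hsmall ε hε
    refine ⟨h₀, h₀pos, fun h hlt j s t hs hst ht => ?_⟩
    have hae : ∀ᵐ x ∂volume.restrict (LineAvg.cube L), ∀ᵐ n ∂LineAvg.sphereMeasure,
        LineAvg.lineInt (φ j) s t n x - LineAvg.lineInt (φ j) s t n (x + h) =
          LineAvg.lineInt (ψ j) s t n x - LineAvg.lineInt (ψ j) s t n (x + h) := by
      refine ae_restrict_of_ae ?_
      filter_upwards [LineAvg.ae_ae_lineInt_eq (hψ j) s t 0,
        LineAvg.ae_ae_lineInt_eq (hψ j) s t h] with x h1 h2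
      simp only [add_zero] at h1
      filter_upwards [h1, h2] with n h3 h4
      rw [h3, h4]
    have e1 : ∫ x in LineAvg.cube L,
          ‖⨍ n, (LineAvg.lineInt (φ j) s t n x - LineAvg.lineInt (φ j) s t n (x + h))
            ∂LineAvg.sphereMeasure‖ ^ 2 = ∫ x in LineAvg.cube L,
          ‖⨍ n, (LineAvg.lineInt (ψ j) s t n x - LineAvg.lineInt (ψ j) s t n (x + h))
            ∂LineAvg.sphereMeasure‖ ^ 2 :=
      integral_congr_ae (hae.mono fun x hx => by
        dsimp only
        rw [LineAvg.average_congr_ae hx])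
    have e2 : ∫ x in LineAvg.cube L,
          ⨍ n, ‖LineAvg.lineInt (φ j) s t n x - LineAvg.lineInt (φ j) s t n (x + h)‖ ^ 2
            ∂LineAvg.sphereMeasure = ∫ x in LineAvg.cube L,
          ⨍ n, ‖LineAvg.lineInt (ψ j) s t n x - LineAvg.lineInt (ψ j) s t n (x + h)‖ ^ 2
            ∂LineAvg.sphereMeasure :=
      integral_congr_ae (hae.mono fun x hx =>
        LineAvg.average_congr_ae (hx.mono fun n hn => by simp only [hn]))
    rw [e1, e2]
    exact ⟨LineAvg.integral_norm_average_lineInt_sub_sq_le (hψm j) (hψb j) hs hst ht h,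
      hh h hlt j s t hs hst ht⟩
  · have h1 : MemLp (LineAvg.powerAvg (ψ j) m s t) 2 (volume.restrict (LineAvg.cube L)) :=
      MemLp.of_bound (LineAvg.stronglyMeasurable_powerAvg (hψm j) m s t).aestronglyMeasurable
        ((C * L) ^ m) (Filter.Eventually.of_forall fun x =>
          LineAvg.norm_powerAvg_le (hψb j) hs hst ht m x)
    exact h1.ae_eq (ae_restrict_of_ae (LineAvg.powerAvg_ae_eq (hψ j) m s t).symm)
  · set S : Set (LineAvg.R3 → 𝕜) := {f | ∃ (j : ℕ) (s t : ℝ), 0 ≤ s ∧ s < t ∧ t ≤ L / 2 ∧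
      f = LineAvg.powerAvg (ψ j) m s t}
    have hcomp : IsCompact (closure {g : Lp 𝕜 2 (volume.restrict (LineAvg.cube L)) |
        ∃ f ∈ S, g =ᵐ[volume.restrict (LineAvg.cube L)] f}) := by
      refine LineAvg.isCompact_closure_L2_of_translates (C := (C * L) ^ m)
        (LineAvg.isCompact_cube L) ?_ ?_ fun e he => ?_
      · rintro f ⟨j, s, t, -, -, -, rfl⟩
        exact LineAvg.stronglyMeasurable_powerAvg (hψm j) m s t
      · rintro f ⟨j, s, t, hs, hst, ht, rfl⟩
        exact LineAvg.norm_powerAvg_le (hψb j) hs hst ht m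
      · set K : ℝ := (m * (C * L) ^ (m - 1)) ^ 2
        have hK0 : 0 ≤ K := by positivity
        -- Dividing by `K + 1` covers `K = 0`, which occurs for instance when `m = 0`.
        obtain ⟨h₀, h₀pos, hh⟩ := hsmall (e / (K + 1)) (by positivity)
        refine ⟨h₀, h₀pos, ?_⟩
        rintro h hlt f ⟨j, s, t, hs, hst, ht, rfl⟩
        calc _ ≤ K * _ := LineAvg.integral_norm_powerAvg_sub_sq_le (hψm j) (hψb j) hs hst ht m h
          _ ≤ K * (e / (K + 1)) := mul_le_mul_of_nonneg_left (hh h hlt j s t hs hst ht).le hK0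
          _ ≤ e := by
            rw [mul_div_assoc', div_le_iff₀ (by positivity)]
            nlinarith
    -- The power averages of `φ j` and `ψ j` agree almost everywhere, so both descriptions give the
    -- same set of `L²` classes.
    convert hcomp using 2
    refine Set.ext fun g => ⟨?_, ?_⟩
    · rintro ⟨j, s, t, hs, hst, ht, hg⟩
      exact ⟨_, ⟨j, s, t, hs, hst, ht, rfl⟩,
        hg.trans (ae_restrict_of_ae (LineAvg.powerAvg_ae_eq (hψ j) m s t))⟩
    · rintro ⟨f, ⟨j, s, t, hs, hst, ht, rfl⟩, hg⟩
      exact ⟨j, s, t, hs, hst, ht,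
        hg.trans (ae_restrict_of_ae (LineAvg.powerAvg_ae_eq (hψ j) m s t).symm)⟩
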